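/- Let $X$ and $U$ be (real or complex) Hilbert spaces, and let $A$, with domain $D(A)$, be the generator of an analytic $C_0$-semigroup $S(t)$ ($t\ge 0$) on $X$ (if $X$ is real, analyticity refers to the complexification of $X$). Let $\gamma\in(0,\tfrac12)$ and let $\rho_0\in\mathbb{R}$ satisfy $\rho_0>\inf_{t>0}\frac1t\ln\|S(t)\|_{\mathcal{L}(X)}$. Let $X_{-\gamma}$ be the dual space, with respect to the pivot space $X$, of $D((\rho_0I-A^*)^\gamma)$ equipped with the norm $\|x\|:=\|(\rho_0I-A^*)^\gamma x\|_X$, and let $B\in\mathcal{L}(U;X_{-\gamma})$, with adjoint $B^*:D((\rho_0I-A^*)^\gamma)\to U$. (Recall that $D(A^*)\subset D((\rho_0I-A^*)^\gamma)$.) Let $\{P_k\}_{k\ge1}$ be a family of orthogonal projections on $X$ such that: 1. $P_kS(t)=S(t)P_k$ for all $k\ge1$ and $t\ge0$; 2. for each $k\ge1$ there are $M_k>0$ and $\alpha_k>0$, with $\alpha_k\to+\infty$ as $k\to+\infty$, such that $$\|(I-P_k)S(t)^*\varphi\|_X\le M_ke^{-\alpha_kt}\|\varphi\|_X\quad\text{for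 all } t\ge0,\ \varphi\in X;$$ 3. there is $T_0>0$ such that for each $k\ge1$ there is $C(k,T_0)>0$ with $$\|P_kS(T_0)^*\varphi\|_X^2\le C(k,T_0)\int_0^{T_0}\|B^*P_kS(t)^*\varphi\|_U^2\,dt\quad\text{for all }\varphi\in D(A^*).$$ Then there is $T_1\ge0$ such that for every $\alpha>0$ there is a constant $C(\alpha)>0$, independent of $T$, such that for every $T>T_1$ there is a constant $D(\alpha,T)>0$ with $$\|S(T)^*\varphi\|_X\le D(\alpha,T)\,\|B^*S(T-\cdot)^*\varphi\|_{L^2(0,T;U)}+C(\alpha)e^{-\alpha T}\|\varphi\|_X\quad\text{for all }\varphi\in D(A^*).$$ -/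

import Mathlib

open Set Filter Topology MeasureTheory

noncomputable section

namespace ControlSystem

universe u v

section Semigroups

variable {𝕜 : Type v} [RCLike 𝕜] {X : Type u} [NormedAddCommGroup X] [InnerProductSpace 𝕜 X]

/-- `S(t)`, `t ≥ 0`, is a `C₀`-semigroup on `X`. (The values of `S` at negative times play no
role.) -/
structure IsC0Semigroup (S : ℝ → X →L[𝕜] X) : Prop where
  zero : S 0 = ContinuousLinearMap.id 𝕜 X
  add : ∀ s t : ℝ, 0 ≤ s → 0 ≤ t → S (s + t) = (S s).comp (S t)
  tendsto_zero : ∀ x : X, Tendsto (fun t : ℝ => S t x) (𝓝[>] 0) (𝓝 x)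

/-- `A` is the infinitesimal generator of `S`: `x ∈ D(A)` and `A x = y` if and only if
`(S(t) x - x) / t → y` as `t → 0⁺`. -/
def IsGenerator (A : X →ₗ.[𝕜] X) (S : ℝ → X →L[𝕜] X) : Prop :=
  ∀ x y : X, (x, y) ∈ A.graph ↔
    Tendsto (fun t : ℝ => (((t⁻¹ : ℝ)) : 𝕜) • (S t x - x)) (𝓝[>] 0) (𝓝 y)

/-- The growth bound `inf_{t > 0} (1/t) ln ‖S(t)‖`, an extended real number (`ln 0 = -∞`). -/
def growthBound (S : ℝ → X →L[𝕜] X) : EReal :=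
  ⨅ t : {t : ℝ // 0 < t}, (((t : ℝ)⁻¹ : ℝ) : EReal) * ENNReal.log ‖S t‖ₑ

/-- The open sector `{z ≠ 0 : |arg z| < θ}`. -/
def sector (θ : ℝ) : Set ℂ := {z | z ≠ 0 ∧ |z.arg| < θ}

/-- The embedding of the scalar field `𝕜` (`ℝ` or `ℂ`) in `ℂ`. -/
def toComplex (c : 𝕜) : ℂ := ⟨RCLike.re c, RCLike.im c⟩

/-- `ι : X → H` exhibits the complex inner product space `H` as the complexification of the inner
product space `X` over `𝕜`. For `𝕜 = ℝ` this says `H = ι X ⊕ i ι X` with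
`‖ι x + i ι y‖² = ‖x‖² + ‖y‖²`; for `𝕜 = ℂ` it says that `ι` is a unitary isomorphism, so that one
may take `H = X`. -/
structure IsComplexification (𝕜 : Type v) [RCLike 𝕜] {X : Type u} [NormedAddCommGroup X]
    [InnerProductSpace 𝕜 X] {H : Type u} [NormedAddCommGroup H] [InnerProductSpace ℂ H]
    (ι : X → H) : Prop where
  map_add : ∀ x y : X, ι (x + y) = ι x + ι y
  map_smul : ∀ (c : 𝕜) (x : X), ι (c • x) = toComplex c • ι x
  inner_map : ∀ x y : X, inner ℂ (ι x) (ι y) = toComplex (inner 𝕜 x y)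
  span_range : Submodule.span ℂ (range ι) = ⊤

/-- `T`, a family of bounded operators on the complex space `H`, is an analytic semigroup in the
sector of half-angle `θ`. -/
structure IsAnalyticInSector {H : Type u} [NormedAddCommGroup H] [InnerProductSpace ℂ H]
    (θ : ℝ) (T : ℂ → H →L[ℂ] H) : Prop where
  differentiableOn : DifferentiableOn ℂ T (sector θ)
  zero : T 0 = ContinuousLinearMap.id ℂ H
  add : ∀ z ∈ sector θ, ∀ w ∈ sector θ, T (z + w) = (T z).comp (T w)
  tendsto_zero : ∀ x : H, Tendsto (fun z => T z x) (𝓝[sector θ] 0) (𝓝 x)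

/-- The semigroup `S` is analytic: (on the complexification of `X`, which is `X` itself if
`𝕜 = ℂ`) it extends to an analytic semigroup in a sector around the positive half-axis. -/
def IsAnalyticSemigroup (S : ℝ → X →L[𝕜] X) : Prop :=
  ∃ (H : Type u) (_ : NormedAddCommGroup H) (_ : InnerProductSpace ℂ H) (ι : X → H),
    IsComplexification 𝕜 ι ∧
    ∃ (θ : ℝ) (T : ℂ → H →L[ℂ] H), 0 < θ ∧ θ ≤ Real.pi / 2 ∧ IsAnalyticInSector θ T ∧
      ∀ t : ℝ, 0 ≤ t → ∀ x : X, T t (ι x) = ι (S t x)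

end Semigroups

section FractionalPowers

variable {𝕜 : Type v} [RCLike 𝕜] {X : Type u} [NormedAddCommGroup X] [InnerProductSpace 𝕜 X]
  [CompleteSpace X]

/-- The bounded operator
`(ρ₀ I - A*)^{-γ} = Γ(γ)⁻¹ ∫₀^∞ t^{γ-1} e^{-ρ₀ t} S(t)* dt`, where `A` generates `S`.
The integral converges in operator norm if `S` is an analytic semigroup, `γ > 0` and `ρ₀` is larger
than the growth bound of `S`. -/
def negFracPower (S : ℝ → X →L[𝕜] X) (ρ₀ γ : ℝ) : X →L[𝕜] X :=
  letI : NormedSpace ℝ (X →L[𝕜] X) := NormedSpace.restrictScalars ℝ 𝕜 (X →L[𝕜] X)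
  (Real.Gamma γ)⁻¹ •
    ∫ t in Ioi (0 : ℝ), (t ^ (γ - 1) * Real.exp (-ρ₀ * t)) • ContinuousLinearMap.adjoint (S t)

/-- The operator `(ρ₀ I - A*)^γ`, the inverse of the injective operator `(ρ₀ I - A*)^{-γ}`; its
domain is the range of the latter. -/
def fracPower (S : ℝ → X →L[𝕜] X) (ρ₀ γ : ℝ) : X →ₗ.[𝕜] X :=
  ((negFracPower S ρ₀ γ : X →ₗ[𝕜] X).toPMap ⊤).inverse

/-- The space `D((ρ₀ I - A*)^γ)`. -/
def FracDomain (S : ℝ → X →L[𝕜] X) (ρ₀ γ : ℝ) : Type u := (fracPower S ρ₀ γ).domain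

instance (S : ℝ → X →L[𝕜] X) (ρ₀ γ : ℝ) : AddCommGroup (FracDomain S ρ₀ γ) :=
  inferInstanceAs (AddCommGroup (fracPower S ρ₀ γ).domain)

instance (S : ℝ → X →L[𝕜] X) (ρ₀ γ : ℝ) : Module 𝕜 (FracDomain S ρ₀ γ) :=
  inferInstanceAs (Module 𝕜 (fracPower S ρ₀ γ).domain)

/-- `(ρ₀ I - A*)^γ` as a linear map on its domain. -/
def fracPowerMap (S : ℝ → X →L[𝕜] X) (ρ₀ γ : ℝ) : FracDomain S ρ₀ γ →ₗ[𝕜] X :=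
  (fracPower S ρ₀ γ).toFun

/-- `D((ρ₀ I - A*)^γ)` carries the norm `‖x‖ = ‖(ρ₀ I - A*)^γ x‖`. -/
instance (S : ℝ → X →L[𝕜] X) (ρ₀ γ : ℝ) : SeminormedAddCommGroup (FracDomain S ρ₀ γ) :=
  SeminormedAddCommGroup.induced _ _ (fracPowerMap S ρ₀ γ)

instance (S : ℝ → X →L[𝕜] X) (ρ₀ γ : ℝ) : NormedSpace 𝕜 (FracDomain S ρ₀ γ) :=
  NormedSpace.induced 𝕜 _ _ (fracPowerMap S ρ₀ γ)

/-- The space `X_{-γ}`, the dual of `D((ρ₀ I - A*)^γ)` with respect to the pivot space `X`: the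
bounded conjugate-linear functionals on `D((ρ₀ I - A*)^γ)`. An element `x` of `X` is identified with
the functional `φ ↦ ⟪φ, x⟫` (the inner product being conjugate-linear in its first argument). -/
abbrev ExtrapolationSpace (S : ℝ → X →L[𝕜] X) (ρ₀ γ : ℝ) : Type (max u v) :=
  FracDomain S ρ₀ γ →L⋆[𝕜] 𝕜

variable {U : Type*} [NormedAddCommGroup U] [InnerProductSpace 𝕜 U] [CompleteSpace U]

/-- The adjoint `B* : D((ρ₀ I - A*)^γ) → U` of `B ∈ L(U; X_{-γ})`: `B* φ` is the element of `U` with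
`⟪B* φ, u⟫_U = (B u)(φ)` for all `u`. -/
def adjointOn {S : ℝ → X →L[𝕜] X} {ρ₀ γ : ℝ} (B : U →L[𝕜] ExtrapolationSpace S ρ₀ γ)
    (φ : FracDomain S ρ₀ γ) : U :=
  (InnerProductSpace.toDual 𝕜 U).symm (B.flip φ)

open scoped Classical in
/-- `B* x` for `x ∈ D((ρ₀ I - A*)^γ)`, which contains `D(A*)`. (The value `0` at the other points of
`X` is a convention.) -/
def controlAdjoint {S : ℝ → X →L[𝕜] X} {ρ₀ γ : ℝ} (B : U →L[𝕜] ExtrapolationSpace S ρ₀ γ)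
    (x : X) : U :=
  if h : x ∈ (fracPower S ρ₀ γ).domain then adjointOn B ⟨x, h⟩ else 0

end FractionalPowers

end ControlSystem

end

/-! Split S(T)*φ into its P_k-part and the rest. The rest decays like e^{-α_k t} by hypothesis 2,
and k is chosen with α_k ≥ α. For the P_k-part, write S(T)* = S(T₀)* S(τ)* with τ = T - T₀ and apply
hypothesis 3 to S(τ)*φ. This produces B* P_k S(t+τ)*φ, which differs from the true observation B*
S(t+τ)*φ by B*(I - P_k)S(t+τ)*φ.

The crux is that this error decays although B* is unbounded. Let N_γ = (ρ₀ - A*)^{-γ}. Then L = B*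
N_γ is bounded, and analyticity gives S(1)* = N_γ R with R bounded and commuting with the semigroup.
As P_k commutes with N_γ, the error is L(I - P_k)S(t+τ-1)* Rφ, of size at most ‖L‖ M_k ‖R‖
e^{-α_k(τ-1)}‖φ‖. One unit of time is spent on smoothing, whence the threshold T₀ + 1.

Since N_γ is given by a Laplace-type integral, the factorisation needs a short calculus: N_γ N_{1-γ}
= N_1 by the Beta integral (`laplacePow_mul_laplacePow`), and N_1 inverts ρ₀ - A* on orbits
(`laplacePow_one_mul`). So R = N_{1-γ}(ρ₀ S(1)* - S'(1)*). The same identity makes N_γ injective and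
the observation of a φ ∈ D(A*) bounded near t = 0. -/

noncomputable section

namespace ControlSystem

/-! ### Laplace-type integrals of semigroups in a Banach algebra. -/

section BanachAlgebra

variable {E : Type*} [NormedRing E] [NormedAlgebra ℝ E]

/-- The unnormalised fractional integral `∫₀^∞ t^{γ-1} e^{-ρ t} V(t) dt` of a family in a Banach
algebra. -/
def laplacePow (V : ℝ → E) (ρ γ : ℝ) : E :=
  ∫ t in Ioi (0 : ℝ), (t ^ (γ - 1) * Real.exp (-ρ * t)) • V t

theorem integrableOn_laplacePow {V : ℝ → E} (hcont : ContinuousOn V (Ioi 0)) {M ω ρ γ : ℝ}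
    (hbd : ∀ t, 0 < t → ‖V t‖ ≤ M * Real.exp (ω * t)) (hω : ω < ρ) (hγ : 0 < γ) :
    IntegrableOn (fun t : ℝ => (t ^ (γ - 1) * Real.exp (-ρ * t)) • V t) (Ioi 0) := by
  have hdom : IntegrableOn (fun t : ℝ => M * (t ^ (γ - 1) * Real.exp (-(ρ - ω) * t ^ (1 : ℝ))))
      (Ioi 0) :=
    (integrableOn_rpow_mul_exp_neg_mul_rpow (by linarith) one_pos (by linarith)).const_mul M
  refine Integrable.mono' hdom ?_ ?_
  · refine ContinuousOn.aestronglyMeasurable ?_ measurableSet_Ioi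
    refine ContinuousOn.smul (ContinuousOn.mul ?_ (by fun_prop)) hcont
    exact continuousOn_id.rpow_const fun x hx => Or.inl (ne_of_gt hx)
  · refine (ae_restrict_iff' measurableSet_Ioi).2 (Eventually.of_forall fun t ht => ?_)
    have ht' : (0 : ℝ) < t := ht
    have hp : 0 ≤ t ^ (γ - 1) * Real.exp (-ρ * t) := by positivity
    rw [norm_smul, Real.norm_of_nonneg hp, Real.rpow_one]
    calc t ^ (γ - 1) * Real.exp (-ρ * t) * ‖V t‖
        ≤ t ^ (γ - 1) * Real.exp (-ρ * t) * (M * Real.exp (ω * t)) := by gcongr; exact hbd t ht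
      _ = M * (t ^ (γ - 1) * (Real.exp (-ρ * t) * Real.exp (ω * t))) := by ring
      _ = M * (t ^ (γ - 1) * Real.exp (-(ρ - ω) * t)) := by
          rw [← Real.exp_add]; ring_nf

theorem commute_laplacePow [CompleteSpace E] {V : ℝ → E} {ρ γ : ℝ}
    (hVint : IntegrableOn (fun t : ℝ => (t ^ (γ - 1) * Real.exp (-ρ * t)) • V t) (Ioi 0)) {W : E}
    (hW : ∀ t, 0 < t → Commute W (V t)) : Commute W (laplacePow V ρ γ) := by
  have h1 := integral_const_mul_of_integrable hVint (c := W)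
  have h2 := integral_mul_const_of_integrable hVint (c := W)
  rw [Commute, SemiconjBy, laplacePow, ← h1, ← h2]
  refine setIntegral_congr_fun measurableSet_Ioi fun t ht => ?_
  simp only [mul_smul_comm, smul_mul_assoc, (hW t ht).eq]

/-- The kernel integral of the Beta function `B(γ, 1 - γ)` is invariant under scaling. -/
theorem integral_rpow_mul_sub_rpow (γ : ℝ) {x : ℝ} (hx : 0 < x) :
    ∫ t in (0 : ℝ)..x, t ^ (γ - 1) * (x - t) ^ ((1 - γ) - 1)
      = ∫ t in (0 : ℝ)..1, t ^ (γ - 1) * (1 - t) ^ ((1 - γ) - 1) := by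
  have h := intervalIntegral.smul_integral_comp_mul_left (a := 0) (b := 1)
    (fun t : ℝ => t ^ (γ - 1) * (x - t) ^ ((1 - γ) - 1)) x
  rw [mul_zero, mul_one] at h
  rw [← h, smul_eq_mul, ← intervalIntegral.integral_const_mul]
  refine intervalIntegral.integral_congr fun t ht => ?_
  rw [uIcc_of_le zero_le_one] at ht
  have e : x - x * t = x * (1 - t) := by ring
  simp only [e]
  rw [Real.mul_rpow hx.le ht.1, Real.mul_rpow hx.le (by linarith [ht.2])]
  have : x * (x ^ (γ - 1) * x ^ ((1 - γ) - 1)) = 1 := by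
    rw [← Real.rpow_add hx, show γ - 1 + (1 - γ - 1) = -1 by ring, Real.rpow_neg_one,
      mul_inv_cancel₀ hx.ne']
  calc x * (x ^ (γ - 1) * t ^ (γ - 1) * (x ^ ((1 - γ) - 1) * (1 - t) ^ ((1 - γ) - 1)))
      = x * (x ^ (γ - 1) * x ^ ((1 - γ) - 1)) * (t ^ (γ - 1) * (1 - t) ^ ((1 - γ) - 1)) := by ring
    _ = _ := by rw [this, one_mul]

/-- The product of two integrals over the half-line is the integral of a convolution. By the
semigroup law V(t)V(x - t) = V(x) leaves the inner integral, and what remains is a scalar Beta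
kernel. -/
theorem laplacePow_mul_laplacePow_eq_integral [CompleteSpace E] {V : ℝ → E}
    (hadd : ∀ s t, 0 < s → 0 < t → V (s + t) = V s * V t) (hcont : ContinuousOn V (Ioi 0))
    {M ω ρ γ : ℝ} (hbd : ∀ t, 0 < t → ‖V t‖ ≤ M * Real.exp (ω * t)) (hω : ω < ρ)
    (hγ : 0 < γ) (hγ' : γ < 1) :
    laplacePow V ρ γ * laplacePow V ρ (1 - γ)
      = (∫ t in (0 : ℝ)..1, t ^ (γ - 1) * (1 - t) ^ ((1 - γ) - 1)) • laplacePow V ρ 1 := by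
  have h := integral_posConvolution (integrableOn_laplacePow hcont hbd hω hγ)
    (integrableOn_laplacePow hcont hbd hω (sub_pos.2 hγ')) (ContinuousLinearMap.mul ℝ E)
  simp only [ContinuousLinearMap.mul_apply'] at h
  rw [laplacePow, laplacePow, ← h, laplacePow, ← integral_smul]
  refine setIntegral_congr_fun measurableSet_Ioi fun x hx => ?_
  have hx' : (0 : ℝ) < x := hx
  simp only [sub_self, Real.rpow_zero, one_mul]
  rw [← integral_rpow_mul_sub_rpow γ hx', ← intervalIntegral.integral_smul_const]
  rw [intervalIntegral.integral_of_le hx'.le, intervalIntegral.integral_of_le hx'.le,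
    integral_Ioc_eq_integral_Ioo, integral_Ioc_eq_integral_Ioo]
  refine setIntegral_congr_fun measurableSet_Ioo fun t ht => ?_
  have e : V x = V t * V (x - t) := by
    rw [← hadd t (x - t) ht.1 (sub_pos.2 ht.2), add_sub_cancel]
  have e' : Real.exp (-ρ * x) = Real.exp (-ρ * t) * Real.exp (-ρ * (x - t)) := by
    rw [← Real.exp_add]; ring_nf
  simp only [e, e', smul_mul_smul_comm, smul_smul]
  congr 1
  ring

/-- The scalar constant does not depend on V, so it is read off from V = 1, ρ = 1, where every
integral is a Gamma value. -/
theorem laplacePow_mul_laplacePow [CompleteSpace E] {V : ℝ → E}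
    (hadd : ∀ s t, 0 < s → 0 < t → V (s + t) = V s * V t) (hcont : ContinuousOn V (Ioi 0))
    {M ω ρ γ : ℝ} (hbd : ∀ t, 0 < t → ‖V t‖ ≤ M * Real.exp (ω * t)) (hω : ω < ρ)
    (hγ : 0 < γ) (hγ' : γ < 1) :
    laplacePow V ρ γ * laplacePow V ρ (1 - γ)
      = (Real.Gamma γ * Real.Gamma (1 - γ)) • laplacePow V ρ 1 := by
  have hΓ : ∀ s : ℝ, 0 < s → laplacePow (fun _ => (1 : ℝ)) 1 s = Real.Gamma s := fun s hs => by
    rw [Real.Gamma_eq_integral hs, laplacePow]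
    refine setIntegral_congr_fun measurableSet_Ioi fun t _ => ?_
    simp [mul_comm]
  have h := laplacePow_mul_laplacePow_eq_integral (V := fun _ : ℝ => (1 : ℝ)) (M := 1) (ω := 0) (ρ := 1)
    (by simp) continuousOn_const (by simp) one_pos hγ hγ'
  rw [hΓ γ hγ, hΓ _ (sub_pos.2 hγ'), hΓ 1 one_pos, Real.Gamma_one, smul_eq_mul, mul_one] at h
  rw [laplacePow_mul_laplacePow_eq_integral hadd hcont hbd hω hγ hγ', h]

/-- The Laplace transform inverts `ρ - V'` along the orbit of the semigroup. -/
theorem laplacePow_one_mul [CompleteSpace E] {V : ℝ → E}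
    (hadd : ∀ s t, 0 < s → 0 < t → V (s + t) = V s * V t) (hcont : ContinuousOn V (Ioi 0))
    {M ω ρ δ : ℝ} (hbd : ∀ t, 0 < t → ‖V t‖ ≤ M * Real.exp (ω * t)) (hω : ω < ρ)
    (hδ : 0 < δ) {V' : E} (hV' : HasDerivAt V V' δ) :
    laplacePow V ρ 1 * (ρ • V δ - V') = V δ := by
  -- Differentiability at the single time δ propagates to all later times by the semigroup law.
  have hder : ∀ t, 0 < t → HasDerivAt V (V t * V') (t + δ) := fun t ht => by
    have h1 : HasDerivAt (fun s => V t * V (s - t)) (V t * V') (t + δ) := by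
      have h2 : HasDerivAt (fun s => V (s - t)) V' (t + δ) := by
        refine HasDerivAt.comp_sub_const (t + δ) t ?_
        rwa [add_sub_cancel_left]
      exact h2.const_mul _
    refine h1.congr_of_eventuallyEq ?_
    filter_upwards [lt_mem_nhds (show t < t + δ by linarith)] with s hs
    rw [← hadd t (s - t) ht (sub_pos.2 hs), add_sub_cancel]
  have hexp : ∀ t : ℝ, HasDerivAt (fun s : ℝ => Real.exp (-ρ * s)) (Real.exp (-ρ * t) * -ρ) t :=
    fun t => by simpa using ((hasDerivAt_id t).const_mul (-ρ)).exp
  have hcδ : ContinuousAt V δ := hV'.continuousAt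
  -- Fundamental theorem of calculus for e^{-ρt} V(t + δ) on the half-line. The trivial factor
  -- t^{1-1} is kept so that the integrand matches `laplacePow` of order 1.
  have key := integral_Ioi_of_hasDerivAt_of_tendsto (a := 0) (m := (0 : E))
    (f := fun t : ℝ => Real.exp (-ρ * t) • V (t + δ))
    (f' := fun t : ℝ => -((t ^ ((1 : ℝ) - 1) * Real.exp (-ρ * t)) • V t * (ρ • V δ - V')))
    ?_ ?_ ?_ ?_
  · rw [integral_neg, integral_mul_const_of_integrable
      (integrableOn_laplacePow hcont hbd hω one_pos)] at key
    simpa [laplacePow] using key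
  · refine ContinuousAt.continuousWithinAt (ContinuousAt.smul (by fun_prop) ?_)
    exact ContinuousAt.comp (f := fun t : ℝ => t + δ) (by simpa using hcδ) (by fun_prop)
  · intro t ht
    have h := (hexp t).smul ((hder t ht).comp_add_const t δ)
    refine h.congr_deriv ?_
    rw [hadd t δ ht hδ]
    simp only [sub_self, Real.rpow_zero, one_mul, smul_mul_assoc, mul_sub, mul_smul_comm,
      smul_smul, mul_neg, neg_smul, mul_comm ρ]
    abel
  · exact ((integrableOn_laplacePow hcont hbd hω one_pos).mul_const _).neg
  · rw [tendsto_zero_iff_norm_tendsto_zero]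
    have hlim : Tendsto (fun t : ℝ => M * Real.exp (ω * δ) * Real.exp (-((ρ - ω) * t))) atTop
        (𝓝 (M * Real.exp (ω * δ) * 0)) :=
      ((Real.tendsto_exp_neg_atTop_nhds_zero.comp
        (tendsto_id.const_mul_atTop (sub_pos.2 hω)))).const_mul _
    rw [mul_zero] at hlim
    refine squeeze_zero' (Eventually.of_forall fun _ => norm_nonneg _) ?_ hlim
    filter_upwards [eventually_gt_atTop 0] with t ht
    rw [norm_smul, Real.norm_of_nonneg (Real.exp_pos _).le]
    calc Real.exp (-ρ * t) * ‖V (t + δ)‖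
        ≤ Real.exp (-ρ * t) * (M * Real.exp (ω * (t + δ))) := by
          gcongr; exact hbd _ (by linarith)
      _ = M * (Real.exp (-ρ * t) * Real.exp (ω * (t + δ))) := by ring
      _ = M * (Real.exp (ω * δ) * Real.exp (-((ρ - ω) * t))) := by
          rw [← Real.exp_add, ← Real.exp_add]; ring_nf
      _ = _ := by ring

end BanachAlgebra

/-! ### Exponential bounds from the growth bound. -/

section Growth

variable {𝕜 : Type*} [RCLike 𝕜] {X : Type*} [NormedAddCommGroup X] [InnerProductSpace 𝕜 X]

theorem IsC0Semigroup.tendsto_of_nonneg {S : ℝ → X →L[𝕜] X} (hS : IsC0Semigroup S) (x : X) :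
    Tendsto (fun t : ℝ => S t x) (𝓝[≥] 0) (𝓝 x) := by
  have h : ContinuousWithinAt (fun t : ℝ => S t x) (Ioi 0) 0 := by
    simpa [ContinuousWithinAt, hS.zero] using hS.tendsto_zero x
  have h' := continuousWithinAt_Ioi_iff_Ici.1 h
  simpa [ContinuousWithinAt, hS.zero] using h'

/-- Otherwise norms blow up along some t_n → 0, while the orbits S(t_n)x converge; this contradicts
uniform boundedness. -/
theorem IsC0Semigroup.exists_bound_near_zero [CompleteSpace X] {S : ℝ → X →L[𝕜] X}
    (hS : IsC0Semigroup S) :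
    ∃ δ : ℝ, 0 < δ ∧ ∃ K : ℝ, 1 ≤ K ∧ ∀ t, 0 ≤ t → t ≤ δ → ‖S t‖ ≤ K := by
  by_contra! hcon
  have h : ∀ n : ℕ, ∃ t : ℝ, 0 ≤ t ∧ t ≤ 1 / ((n : ℝ) + 1) ∧ (n : ℝ) + 1 < ‖S t‖ := fun n =>
    hcon (1 / ((n : ℝ) + 1)) (by positivity) ((n : ℝ) + 1) (by simp)
  choose t ht0 ht1 ht2 using h
  have htend : Tendsto t atTop (𝓝[≥] 0) := by
    refine tendsto_nhdsWithin_iff.2 ⟨?_, Eventually.of_forall ht0⟩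
    exact squeeze_zero ht0 ht1 tendsto_one_div_add_atTop_nhds_zero_nat
  obtain ⟨C, hC⟩ := banach_steinhaus (g := fun n : ℕ => S (t n)) fun x => by
    have hx := ((hS.tendsto_of_nonneg x).comp htend).norm
    obtain ⟨C, hC⟩ := hx.bddAbove_range
    exact ⟨C, fun n => hC ⟨n, rfl⟩⟩
  obtain ⟨n, hn⟩ := exists_nat_gt C
  linarith [hC n, ht2 n]

theorem IsC0Semigroup.exists_bound_on [CompleteSpace X] {S : ℝ → X →L[𝕜] X}
    (hS : IsC0Semigroup S) (b : ℝ) :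
    ∃ K : ℝ, 1 ≤ K ∧ ∀ t, 0 ≤ t → t ≤ b → ‖S t‖ ≤ K := by
  obtain ⟨δ, hδ, K, hK, hb⟩ := hS.exists_bound_near_zero
  have key : ∀ n : ℕ, ∀ t, 0 ≤ t → t ≤ n * δ → ‖S t‖ ≤ K ^ (n + 1) := by
    intro n
    induction n with
    | zero =>
      intro t h0 h1
      simpa using hb t h0 (by norm_num at h1; linarith)
    | succ n ih =>
      intro t h0 h1
      rcases le_total t δ with h | h
      · exact (hb t h0 h).trans (le_self_pow₀ hK (by omega))
      · have e : S t = (S δ).comp (S (t - δ)) := by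
          rw [← hS.add δ (t - δ) hδ.le (by linarith), add_sub_cancel]
        push_cast at h1
        rw [e, pow_succ, mul_comm]
        refine (ContinuousLinearMap.opNorm_comp_le _ _).trans ?_
        gcongr
        · exact hb δ hδ.le le_rfl
        · exact ih _ (by linarith) (by linarith)
  obtain ⟨n, hn⟩ := exists_nat_ge (b / δ)
  refine ⟨K ^ (n + 1), one_le_pow₀ hK, fun t h0 h1 => key n t h0 (h1.trans ?_)⟩
  exact (div_le_iff₀ hδ).1 hn

theorem exists_norm_le_exp_of_growthBound_lt {S : ℝ → X →L[𝕜] X} {ρ : ℝ}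
    (hρ : growthBound S < (ρ : EReal)) :
    ∃ t₀ ω : ℝ, 0 < t₀ ∧ ω < ρ ∧ ‖S t₀‖ ≤ Real.exp (ω * t₀) := by
  obtain ⟨⟨t, ht⟩, h⟩ := iInf_lt_iff.1 hρ
  simp only at h
  have ht' : 0 < t⁻¹ := inv_pos.2 ht
  -- Here the logarithm is -∞, and any rate below ρ will do.
  by_cases h0 : S t = 0
  · exact ⟨t, ρ - 1, ht, by linarith, by rw [h0, norm_zero]; positivity⟩
  have hpos : 0 < ‖S t‖ := norm_pos_iff.2 h0
  have hlog : ENNReal.log ‖S t‖ₑ = ((Real.log ‖S t‖ : ℝ) : EReal) := by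
    rw [ENNReal.log_pos_real' (by simpa using hpos)]
    simp
  rw [hlog, ← EReal.coe_mul, EReal.coe_lt_coe_iff] at h
  refine ⟨t, t⁻¹ * Real.log ‖S t‖, ht, h, ?_⟩
  rw [mul_right_comm, inv_mul_cancel₀ ht.ne', one_mul, Real.exp_log hpos]

/-- A semigroup whose growth bound is less than `ρ` is exponentially bounded with rate less than
`ρ`. -/
theorem IsC0Semigroup.exists_exp_bound [CompleteSpace X] {S : ℝ → X →L[𝕜] X}
    (hS : IsC0Semigroup S) {ρ : ℝ} (hρ : growthBound S < (ρ : EReal)) :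
    ∃ M ω : ℝ, ω < ρ ∧ ∀ t, 0 ≤ t → ‖S t‖ ≤ M * Real.exp (ω * t) := by
  obtain ⟨t₀, ω, ht₀, hω, hb⟩ := exists_norm_le_exp_of_growthBound_lt hρ
  obtain ⟨K, hK, hKb⟩ := hS.exists_bound_on t₀
  have key : ∀ n : ℕ, ∀ r, 0 ≤ r → r ≤ t₀ →
      ‖S (n * t₀ + r)‖ ≤ Real.exp (ω * (n * t₀)) * K := by
    intro n
    induction n with
    | zero => intro r h0 h1; simpa using hKb r h0 h1
    | succ n ih =>
      intro r h0 h1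
      have e : S ((n + 1 : ℕ) * t₀ + r) = (S t₀).comp (S (n * t₀ + r)) := by
        rw [← hS.add t₀ _ ht₀.le (by positivity)]
        congr 1; push_cast; ring
      rw [e]
      refine (ContinuousLinearMap.opNorm_comp_le _ _).trans ?_
      calc ‖S t₀‖ * ‖S (n * t₀ + r)‖
          ≤ Real.exp (ω * t₀) * (Real.exp (ω * (n * t₀)) * K) := by
            gcongr; exact ih r h0 h1
        _ = Real.exp (ω * ((n + 1 : ℕ) * t₀)) * K := by
            rw [← mul_assoc, ← Real.exp_add]; congr 2; push_cast; ring
  -- With t = n t₀ + r, the factor e^{|ω|t₀} absorbs e^{-ωr}, which matters when ω < 0.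
  refine ⟨K * Real.exp (|ω| * t₀), ω, hω, fun t ht => ?_⟩
  have hn1 : ((⌊t / t₀⌋₊ : ℕ) : ℝ) * t₀ ≤ t :=
    (le_div_iff₀ ht₀).1 (Nat.floor_le (by positivity))
  have hn2 : t < (((⌊t / t₀⌋₊ : ℕ) : ℝ) + 1) * t₀ := (div_lt_iff₀ ht₀).1 (Nat.lt_floor_add_one _)
  set n : ℕ := ⌊t / t₀⌋₊
  have h := key n (t - n * t₀) (by linarith) (by linarith)
  rw [add_sub_cancel] at h
  refine h.trans ?_
  rw [mul_comm, mul_assoc, ← Real.exp_add]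
  gcongr
  have h1 : -ω * (t - n * t₀) ≤ |ω| * t₀ :=
    (mul_le_mul_of_nonneg_right (neg_le_abs ω) (by linarith)).trans
      (mul_le_mul_of_nonneg_left (by linarith) (abs_nonneg ω))
  linarith

end Growth

/-! ### Norm differentiability of analytic semigroups and their adjoints. -/

section Analytic

universe u

variable {𝕜 : Type*} [RCLike 𝕜] {X : Type u} [NormedAddCommGroup X] [InnerProductSpace 𝕜 X]

/-- The bounded operators on a space over `𝕜` as a real normed algebra. -/
abbrev operatorRealAlgebra : NormedAlgebra ℝ (X →L[𝕜] X) :=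
  NormedAlgebra.restrictScalars ℝ 𝕜 (X →L[𝕜] X)

attribute [local instance] operatorRealAlgebra

theorem real_smul_operator_eq (r : ℝ) (L : X →L[𝕜] X) : r • L = (r : 𝕜) • L := rfl

theorem toComplex_ofReal (r : ℝ) : toComplex (r : 𝕜) = (r : ℂ) := by
  apply Complex.ext <;> simp [toComplex]

theorem IsComplexification.norm_map {H : Type u} [NormedAddCommGroup H]
    [InnerProductSpace ℂ H] {ι : X → H} (h : IsComplexification 𝕜 ι) (x : X) : ‖ι x‖ = ‖x‖ := by
  rw [← sq_eq_sq₀ (norm_nonneg _) (norm_nonneg _), ← inner_self_eq_norm_sq (𝕜 := ℂ),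
    ← inner_self_eq_norm_sq (𝕜 := 𝕜), h.inner_map]
  rfl

theorem IsComplexification.map_sub {H : Type u} [NormedAddCommGroup H]
    [InnerProductSpace ℂ H] {ι : X → H} (h : IsComplexification 𝕜 ι) (x y : X) :
    ι (x - y) = ι x - ι y := by
  rw [eq_sub_iff_add_eq, ← h.map_add, sub_add_cancel]

theorem IsComplexification.map_ofReal_smul {H : Type u} [NormedAddCommGroup H]
    [InnerProductSpace ℂ H] {ι : X → H} (h : IsComplexification 𝕜 ι) (r : ℝ) (x : X) :
    ι ((r : 𝕜) • x) = (r : ℂ) • ι x := by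
  rw [h.map_smul, toComplex_ofReal]

/-- An analytic semigroup is differentiable in operator norm at positive times. -/
theorem IsAnalyticSemigroup.exists_hasDerivAt [CompleteSpace X] {S : ℝ → X →L[𝕜] X}
    (hS : IsAnalyticSemigroup S) {t : ℝ} (ht : 0 < t) : ∃ S' : X →L[𝕜] X, HasDerivAt S S' t := by
  obtain ⟨H, _, _, ι, hι, θ, T, hθ, -, hT, hTS⟩ := hS
  have hsec : MapsTo (fun s : ℝ => (s : ℂ)) (Ioi 0) (sector θ) := fun s hs => by
    have hs' : (0 : ℝ) < s := hs
    exact ⟨Complex.ofReal_ne_zero.2 hs'.ne',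
      by rw [Complex.arg_ofReal_of_nonneg hs'.le]; simpa using hθ⟩
  have hdiff : DifferentiableAt ℝ (fun s : ℝ => T (s : ℂ)) t := by
    have h1 : DifferentiableWithinAt ℝ T (sector θ) (t : ℂ) :=
      (hT.differentiableOn _ (hsec ht)).restrictScalars ℝ
    have h2 : DifferentiableWithinAt ℝ (fun s : ℝ => (s : ℂ)) (Ioi 0) t :=
      Complex.ofRealCLM.differentiableAt.differentiableWithinAt
    exact (h1.comp t h2 hsec).differentiableAt (Ioi_mem_nhds ht)
  have hslope := hasDerivAt_iff_tendsto_slope.1 hdiff.hasDerivAt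
  have hcT := (cauchy_map_iff.1 hslope.cauchy_map).2
  rw [tendsto_uniformity_iff_dist_tendsto_zero] at hcT
  -- The derivative of T need not visibly preserve ι X, so no limit is pulled back. Since ι is
  -- isometric and intertwines S with T, differences of slopes of S are dominated by those of T;
  -- completeness of the operators on X then gives the limit.
  have hcS : Cauchy (map (slope S t) (𝓝[≠] t)) := by
    refine cauchy_map_iff.2 ⟨inferInstance, ?_⟩
    rw [tendsto_uniformity_iff_dist_tendsto_zero]
    refine squeeze_zero' (Eventually.of_forall fun _ => dist_nonneg) ?_ hcT
    have hpos : ∀ᶠ s in 𝓝[≠] t, 0 < s := (lt_mem_nhds ht).filter_mono nhdsWithin_le_nhds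
    filter_upwards [hpos.prod_mk hpos] with p hp
    rw [dist_eq_norm, dist_eq_norm]
    refine ContinuousLinearMap.opNorm_le_bound _ (norm_nonneg _) fun x => ?_
    rw [← hι.norm_map, ← hι.norm_map x]
    refine le_trans (le_of_eq ?_) (ContinuousLinearMap.le_opNorm _ (ι x))
    congr 1
    simp only [slope_def_module, real_smul_operator_eq, _root_.sub_apply,
      _root_.smul_apply, hι.map_sub, hι.map_ofReal_smul]
    rw [← hTS _ hp.1.le, ← hTS _ hp.2.le, ← hTS _ ht.le]
    rfl
  obtain ⟨S', hS'⟩ := CompleteSpace.complete hcS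
  exact ⟨S', hasDerivAt_iff_tendsto_slope.2 hS'⟩

theorem hasDerivAt_adjoint [CompleteSpace X] {S : ℝ → X →L[𝕜] X} {S' : X →L[𝕜] X} {t : ℝ}
    (h : HasDerivAt S S' t) :
    HasDerivAt (fun s => ContinuousLinearMap.adjoint (S s)) (ContinuousLinearMap.adjoint S') t := by
  rw [hasDerivAt_iff_tendsto_slope] at h ⊢
  have h' := ((ContinuousLinearMap.adjoint (𝕜 := 𝕜) (E := X) (F := X)).continuous.tendsto S').comp h
  refine h'.congr fun s => ?_
  simp only [Function.comp_apply, slope_def_module, real_smul_operator_eq, map_smulₛₗ, map_sub,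
    RCLike.conj_ofReal]

end Analytic

/-! ### Smoothing into D(A) and D(A*). -/

section Generator

variable {𝕜 : Type*} [RCLike 𝕜] {X : Type*} [NormedAddCommGroup X] [InnerProductSpace 𝕜 X]

attribute [local instance] operatorRealAlgebra

theorem tendsto_smul_sub_apply {S : ℝ → X →L[𝕜] X} {t : ℝ} {S' : X →L[𝕜] X}
    (h : HasDerivAt S S' t) (x : X) :
    Tendsto (fun r : ℝ => ((r⁻¹ : ℝ) : 𝕜) • (S (t + r) x - S t x)) (𝓝[>] 0) (𝓝 (S' x)) :=
  ((ContinuousLinearMap.apply 𝕜 X x).continuous.tendsto S').comp h.tendsto_slope_zero_right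

/-- Factoring S(t + r) = S(r)S(t) turns the difference quotient of S at t into the one defining A at
S(t)x. The next lemma factors S(t) out on the other side. -/
theorem IsGenerator.mem_graph_of_hasDerivAt {A : X →ₗ.[𝕜] X} {S : ℝ → X →L[𝕜] X}
    (hS : IsC0Semigroup S) (hA : IsGenerator A S) {t : ℝ} (ht : 0 < t) {S' : X →L[𝕜] X}
    (h : HasDerivAt S S' t) (x : X) : (S t x, S' x) ∈ A.graph := by
  refine (hA _ _).2 ((tendsto_smul_sub_apply h x).congr' ?_)
  filter_upwards [self_mem_nhdsWithin] with r hr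
  rw [add_comm t r, hS.add r t (le_of_lt hr) ht.le]
  rfl

theorem IsGenerator.apply_eq_of_mem_graph {A : X →ₗ.[𝕜] X} {S : ℝ → X →L[𝕜] X}
    (hS : IsC0Semigroup S) (hA : IsGenerator A S) {t : ℝ} (ht : 0 < t) {S' : X →L[𝕜] X}
    (h : HasDerivAt S S' t) {x y : X} (hxy : (x, y) ∈ A.graph) : S t y = S' x := by
  refine tendsto_nhds_unique ((((S t).continuous.tendsto y).comp ((hA x y).1 hxy)).congr' ?_)
    (tendsto_smul_sub_apply h x)
  filter_upwards [self_mem_nhdsWithin] with r hr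
  rw [hS.add t r ht.le (le_of_lt hr)]
  simp

theorem IsGenerator.dense_domain [CompleteSpace X] {A : X →ₗ.[𝕜] X} {S : ℝ → X →L[𝕜] X}
    (hS : IsC0Semigroup S) (hA : IsGenerator A S) (hSan : IsAnalyticSemigroup S) :
    Dense (A.domain : Set X) := fun x => by
  refine mem_closure_of_tendsto (hS.tendsto_zero x) ?_
  filter_upwards [self_mem_nhdsWithin] with t ht
  obtain ⟨S', hS'⟩ := hSan.exists_hasDerivAt ht
  exact LinearPMap.mem_domain_of_mem_graph (hA.mem_graph_of_hasDerivAt hS ht hS' x)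

theorem IsGenerator.adjoint_deriv_apply [CompleteSpace X] {A : X →ₗ.[𝕜] X} {S : ℝ → X →L[𝕜] X}
    (hS : IsC0Semigroup S) (hA : IsGenerator A S) (hSan : IsAnalyticSemigroup S) {t : ℝ}
    (ht : 0 < t) {S' : X →L[𝕜] X} (h : HasDerivAt S S' t) (φ : A.adjoint.domain) :
    ContinuousLinearMap.adjoint S' (φ : X) = ContinuousLinearMap.adjoint (S t) (A.adjoint φ) := by
  refine ext_inner_right 𝕜 fun x => ?_
  obtain ⟨z, hz, hz'⟩ := (LinearPMap.mem_graph_iff A).1 (hA.mem_graph_of_hasDerivAt hS ht h x)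
  have hd := LinearPMap.adjoint_isFormalAdjoint (hA.dense_domain hS hSan) φ z
  rw [ContinuousLinearMap.adjoint_inner_left, ContinuousLinearMap.adjoint_inner_left]
  simp only at hz hz'
  rw [← hz, hd, hz']

/-- For x ∈ D(A), ⟪S(t)*φ, Ax⟫ = ⟪φ, S'(t)x⟫ is bounded in x because S'(t) is. -/
theorem IsGenerator.adjoint_apply_mem_domain [CompleteSpace X] {A : X →ₗ.[𝕜] X}
    {S : ℝ → X →L[𝕜] X} (hS : IsC0Semigroup S) (hA : IsGenerator A S)
    (hSan : IsAnalyticSemigroup S) {t : ℝ} (ht : 0 < t) (φ : X) :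
    ContinuousLinearMap.adjoint (S t) φ ∈ A.adjoint.domain := by
  obtain ⟨S', hS'⟩ := hSan.exists_hasDerivAt ht
  refine LinearPMap.mem_adjoint_domain_of_exists _ ⟨ContinuousLinearMap.adjoint S' φ, fun x => ?_⟩
  rw [ContinuousLinearMap.adjoint_inner_left, ContinuousLinearMap.adjoint_inner_left,
    hA.apply_eq_of_mem_graph hS ht hS' (A.mem_graph x)]

end Generator

/-! ### The operators N_γ: commutation, injectivity, factorisation. -/

section FractionalPower

variable {𝕜 : Type*} [RCLike 𝕜] {X : Type*} [NormedAddCommGroup X] [InnerProductSpace 𝕜 X]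
  [CompleteSpace X]

attribute [local instance] operatorRealAlgebra

theorem negFracPower_eq (S : ℝ → X →L[𝕜] X) (ρ γ : ℝ) :
    negFracPower S ρ γ
      = (Real.Gamma γ)⁻¹ • laplacePow (fun t => ContinuousLinearMap.adjoint (S t)) ρ γ := rfl

theorem IsC0Semigroup.adjoint_add {S : ℝ → X →L[𝕜] X} (hS : IsC0Semigroup S) {s t : ℝ}
    (hs : 0 ≤ s) (ht : 0 ≤ t) : ContinuousLinearMap.adjoint (S (s + t))
      = ContinuousLinearMap.adjoint (S s) * ContinuousLinearMap.adjoint (S t) := by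
  rw [add_comm s t, hS.add t s ht hs, ContinuousLinearMap.adjoint_comp]
  rfl

theorem IsC0Semigroup.commute_adjoint {S : ℝ → X →L[𝕜] X} (hS : IsC0Semigroup S) {s t : ℝ}
    (hs : 0 ≤ s) (ht : 0 ≤ t) :
    Commute (ContinuousLinearMap.adjoint (S s)) (ContinuousLinearMap.adjoint (S t)) := by
  rw [Commute, SemiconjBy, ← hS.adjoint_add hs ht, ← hS.adjoint_add ht hs, add_comm]

theorem IsC0Semigroup.commute_adjoint_deriv {S : ℝ → X →L[𝕜] X} (hS : IsC0Semigroup S) {s t : ℝ}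
    (hs : 0 < s) (ht : 0 < t) {S' : X →L[𝕜] X} (h : HasDerivAt S S' t) :
    Commute (ContinuousLinearMap.adjoint (S s)) (ContinuousLinearMap.adjoint S') := by
  have h' := hasDerivAt_adjoint h
  refine (h'.const_mul (ContinuousLinearMap.adjoint (S s))).unique
    ((h'.mul_const (ContinuousLinearMap.adjoint (S s))).congr_of_eventuallyEq ?_)
  filter_upwards [lt_mem_nhds ht] with r hr
  exact (hS.commute_adjoint hs.le hr.le).eq

theorem IsAnalyticSemigroup.continuousOn_adjoint {S : ℝ → X →L[𝕜] X}
    (hSan : IsAnalyticSemigroup S) :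
    ContinuousOn (fun t => ContinuousLinearMap.adjoint (S t)) (Ioi 0) := fun t ht => by
  obtain ⟨S', hS'⟩ := hSan.exists_hasDerivAt ht
  exact (hasDerivAt_adjoint hS').continuousAt.continuousWithinAt

theorem commute_negFracPower {S : ℝ → X →L[𝕜] X} (hS : IsC0Semigroup S)
    (hSan : IsAnalyticSemigroup S) {ρ γ : ℝ} (hρ : growthBound S < (ρ : EReal)) (hγ : 0 < γ)
    {W : X →L[𝕜] X} (hW : ∀ t, 0 < t → Commute W (ContinuousLinearMap.adjoint (S t))) :
    Commute W (negFracPower S ρ γ) := by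
  obtain ⟨M, ω, hω, hb⟩ := hS.exists_exp_bound hρ
  rw [negFracPower_eq]
  refine Commute.smul_right (commute_laplacePow ?_ hW) _
  refine integrableOn_laplacePow hSan.continuousOn_adjoint (M := M) (fun t ht => ?_) hω hγ
  rw [LinearIsometryEquiv.norm_map]
  exact hb t ht.le

/-- The fractional power of order `-γ`, composed with the one of order `γ - 1`, inverts `ρ - A*` on
the orbits of the adjoint semigroup. -/
theorem negFracPower_mul_mul_eq {S : ℝ → X →L[𝕜] X} (hS : IsC0Semigroup S)
    (hSan : IsAnalyticSemigroup S) {ρ γ : ℝ} (hρ : growthBound S < (ρ : EReal)) (hγ : 0 < γ)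
    (hγ' : γ < 1) {t : ℝ} (ht : 0 < t) {S' : X →L[𝕜] X} (h : HasDerivAt S S' t) :
    negFracPower S ρ γ * negFracPower S ρ (1 - γ)
      * (ρ • ContinuousLinearMap.adjoint (S t) - ContinuousLinearMap.adjoint S')
      = ContinuousLinearMap.adjoint (S t) := by
  obtain ⟨M, ω, hω, hb⟩ := hS.exists_exp_bound hρ
  have hb' : ∀ t, 0 < t → ‖ContinuousLinearMap.adjoint (S t)‖ ≤ M * Real.exp (ω * t) :=
    fun t ht => by rw [LinearIsometryEquiv.norm_map]; exact hb t ht.le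
  have hadd : ∀ s t, 0 < s → 0 < t → ContinuousLinearMap.adjoint (S (s + t))
      = ContinuousLinearMap.adjoint (S s) * ContinuousLinearMap.adjoint (S t) :=
    fun s t hs ht => hS.adjoint_add hs.le ht.le
  have h1 := laplacePow_mul_laplacePow hadd hSan.continuousOn_adjoint hb' hω hγ hγ'
  have h2 := laplacePow_one_mul hadd hSan.continuousOn_adjoint hb' hω ht (hasDerivAt_adjoint h)
  have hΓ : Real.Gamma γ ≠ 0 := (Real.Gamma_pos_of_pos hγ).ne'
  have hΓ' : Real.Gamma (1 - γ) ≠ 0 := (Real.Gamma_pos_of_pos (sub_pos.2 hγ')).ne'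
  rw [negFracPower_eq, negFracPower_eq, smul_mul_smul_comm, h1, smul_smul, ← mul_inv,
    inv_mul_cancel₀ (mul_ne_zero hΓ hΓ'), one_smul, h2]

/-- Only weak continuity of the adjoint semigroup is needed: ⟪y, S(t)y⟫ tends to ‖y‖². -/
theorem eq_zero_of_adjoint_apply_eq_zero {S : ℝ → X →L[𝕜] X} (hS : IsC0Semigroup S) {y : X}
    (hy : ∀ t, 0 < t → ContinuousLinearMap.adjoint (S t) y = 0) : y = 0 := by
  have h : Tendsto (fun t : ℝ => inner 𝕜 y (S t y)) (𝓝[>] 0) (𝓝 (inner 𝕜 y y)) :=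
    tendsto_const_nhds.inner (hS.tendsto_zero y)
  have h0 : Tendsto (fun t : ℝ => inner 𝕜 y (S t y)) (𝓝[>] 0) (𝓝 0) := by
    refine tendsto_const_nhds.congr' ?_
    filter_upwards [self_mem_nhdsWithin] with t ht
    rw [← ContinuousLinearMap.adjoint_inner_left, hy t ht, inner_zero_left]
  exact inner_self_eq_zero.1 (tendsto_nhds_unique h h0)

theorem negFracPower_injective {S : ℝ → X →L[𝕜] X} (hS : IsC0Semigroup S)
    (hSan : IsAnalyticSemigroup S) {ρ γ : ℝ} (hρ : growthBound S < (ρ : EReal)) (hγ : 0 < γ)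
    (hγ' : γ < 1) : Function.Injective (negFracPower S ρ γ) := by
  refine (injective_iff_map_eq_zero _).2 fun y hy => eq_zero_of_adjoint_apply_eq_zero hS
    fun t ht => ?_
  obtain ⟨S', hS'⟩ := hSan.exists_hasDerivAt ht
  have hself : ∀ s, 0 < s → Commute (ContinuousLinearMap.adjoint (S s)) (negFracPower S ρ γ) :=
    fun s hs => commute_negFracPower hS hSan hρ hγ fun r hr => hS.commute_adjoint hs.le hr.le
  have hQ : Commute (negFracPower S ρ γ) (negFracPower S ρ (1 - γ)) :=
    commute_negFracPower hS hSan hρ (sub_pos.2 hγ') fun s hs => (hself s hs).symm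
  have hS'c : Commute (ContinuousLinearMap.adjoint S') (negFracPower S ρ γ) :=
    commute_negFracPower hS hSan hρ hγ fun s hs => (hS.commute_adjoint_deriv hs ht hS').symm
  -- All factors commute, so S(t)* = N_γ N_{1-γ} G can be rewritten with N_γ acting first, where G =
  -- ρ S(t)* - S'(t)*; thus N_γ y = 0 forces S(t)*y = 0.
  have hG := hQ.mul_right
    ((((hself t ht).smul_left ρ).sub_left hS'c).symm)
  rw [← negFracPower_mul_mul_eq hS hSan hρ hγ hγ' ht hS', mul_assoc, hG.eq,
    mul_apply_eq_comp, hy, map_zero]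

section ControlAdjoint

variable {S : ℝ → X →L[𝕜] X} {ρ γ : ℝ}

theorem negFracPower_apply_mem (y : X) : negFracPower S ρ γ y ∈ (fracPower S ρ γ).domain := by
  rw [fracPower, LinearPMap.inverse_domain]
  exact ⟨⟨y, Submodule.mem_top⟩, rfl⟩

/-- `(ρ I - A*)^{-γ}` as a map onto the domain of `(ρ I - A*)^γ`. -/
def toFracDomain (S : ℝ → X →L[𝕜] X) (ρ γ : ℝ) : X →ₗ[𝕜] FracDomain S ρ γ :=
  LinearMap.codRestrict (fracPower S ρ γ).domain (negFracPower S ρ γ : X →ₗ[𝕜] X)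
    negFracPower_apply_mem

theorem norm_toFracDomain (hinj : Function.Injective (negFracPower S ρ γ)) (y : X) :
    ‖toFracDomain S ρ γ y‖ = ‖y‖ := by
  -- A trivial kernel is what makes `LinearPMap.inverse` a genuine inverse.
  have hker : ((negFracPower S ρ γ : X →ₗ[𝕜] X).toPMap ⊤).toFun.ker = ⊥ := by
    refine LinearMap.ker_eq_bot'.2 fun m hm => Subtype.ext (hinj ?_)
    rw [Submodule.coe_zero, map_zero]
    exact hm
  change ‖fracPower S ρ γ (toFracDomain S ρ γ y)‖ = ‖y‖
  exact congrArg _ (LinearPMap.inverse_apply_eq hker (x := ⟨y, Submodule.mem_top⟩) rfl)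

variable {U : Type*} [NormedAddCommGroup U] [InnerProductSpace 𝕜 U] [CompleteSpace U]

/-- `B* (ρ I - A*)^{-γ}` is a bounded operator from `X` to `U`. -/
theorem exists_controlAdjoint_negFracPower (B : U →L[𝕜] ExtrapolationSpace S ρ γ)
    (hinj : Function.Injective (negFracPower S ρ γ)) :
    ∃ L : X →L[𝕜] U, ∀ y, controlAdjoint B (negFracPower S ρ γ y) = L y := by
  let J : X →L[𝕜] FracDomain S ρ γ := (toFracDomain S ρ γ).mkContinuous 1 fun y => by
    rw [norm_toFracDomain hinj, one_mul]
  let D : (U →L[𝕜] 𝕜) →L⋆[𝕜] U :=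
    ((InnerProductSpace.toDual 𝕜 U).symm.toContinuousLinearEquiv : (U →L[𝕜] 𝕜) →L⋆[𝕜] U)
  -- The inverse Riesz map and `B.flip` are both conjugate-linear, so the composite is linear.
  refine ⟨(D.comp B.flip).comp J, fun y => ?_⟩
  rw [controlAdjoint, dif_pos (negFracPower_apply_mem y)]
  rfl

end ControlAdjoint

end FractionalPower

/-! ### Integrability of the observation and the projected estimate. -/

section Observation

variable {𝕜 : Type*} [RCLike 𝕜] {X : Type*} [NormedAddCommGroup X] [InnerProductSpace 𝕜 X]
  [CompleteSpace X] {U : Type*} [NormedAddCommGroup U] [InnerProductSpace 𝕜 U] [CompleteSpace U]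

attribute [local instance] operatorRealAlgebra

/-- The adjoint semigroup maps into the domain of the fractional power, with a bounded factor that
commutes with the semigroup. -/
theorem exists_negFracPower_mul_eq_adjoint {S : ℝ → X →L[𝕜] X} (hS : IsC0Semigroup S)
    (hSan : IsAnalyticSemigroup S) {ρ γ : ℝ} (hρ : growthBound S < (ρ : EReal)) (hγ : 0 < γ)
    (hγ' : γ < 1) {t : ℝ} (ht : 0 < t) :
    ∃ R : X →L[𝕜] X, (∀ y, negFracPower S ρ γ (R y) = ContinuousLinearMap.adjoint (S t) y) ∧
      ∀ s, 0 < s → ∀ y, R (ContinuousLinearMap.adjoint (S s) y)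
        = ContinuousLinearMap.adjoint (S s) (R y) := by
  obtain ⟨S', hS'⟩ := hSan.exists_hasDerivAt ht
  refine ⟨negFracPower S ρ (1 - γ)
    * (ρ • ContinuousLinearMap.adjoint (S t) - ContinuousLinearMap.adjoint S'), fun y => ?_,
    fun s hs y => ?_⟩
  · have h := negFracPower_mul_mul_eq hS hSan hρ hγ hγ' ht hS'
    rw [mul_assoc] at h
    exact DFunLike.congr_fun h y
  · have h1 : Commute (ContinuousLinearMap.adjoint (S s)) (negFracPower S ρ (1 - γ)) :=
      commute_negFracPower hS hSan hρ (sub_pos.2 hγ') fun r hr => hS.commute_adjoint hs.le hr.le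
    have h2 := h1.mul_right (((hS.commute_adjoint hs.le ht.le).smul_right ρ).sub_right
      (hS.commute_adjoint_deriv hs ht hS'))
    exact (DFunLike.congr_fun h2.eq y).symm

theorem continuousOn_adjoint_apply {S : ℝ → X →L[𝕜] X} (hSan : IsAnalyticSemigroup S) (x : X) :
    ContinuousOn (fun t => ContinuousLinearMap.adjoint (S t) x) (Ioi 0) :=
  (ContinuousLinearMap.apply 𝕜 X x).continuous.comp_continuousOn hSan.continuousOn_adjoint

/-- The observation `t ↦ B* S(t)* φ` is square integrable on bounded intervals if `φ ∈ D(A*)`. -/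
theorem intervalIntegrable_sq_norm_controlAdjoint {A : X →ₗ.[𝕜] X} {S : ℝ → X →L[𝕜] X}
    (hS : IsC0Semigroup S) (hA : IsGenerator A S) (hSan : IsAnalyticSemigroup S) {ρ γ : ℝ}
    (hρ : growthBound S < (ρ : EReal)) (hγ : 0 < γ) (hγ' : γ < 1)
    (B : U →L[𝕜] ExtrapolationSpace S ρ γ) {φ : X} (hφ : φ ∈ A.adjoint.domain) {T : ℝ}
    (hT : 0 ≤ T) :
    IntervalIntegrable (fun t => ‖controlAdjoint B (ContinuousLinearMap.adjoint (S t) φ)‖ ^ 2)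
      volume 0 T := by
  obtain ⟨L, hL⟩ := exists_controlAdjoint_negFracPower B (negFracPower_injective hS hSan hρ hγ hγ')
  -- With ψ = (ρ - A*)φ one has B* S(t)*φ = L N_{1-γ} S(t)*ψ, which stays bounded as t → 0.
  set ψ : X := (ρ : 𝕜) • φ - A.adjoint ⟨φ, hφ⟩ with hψ
  set Q := negFracPower S ρ (1 - γ) with hQ
  have hrep : EqOn (fun t => ‖L (Q (ContinuousLinearMap.adjoint (S t) ψ))‖ ^ 2)
      (fun t => ‖controlAdjoint B (ContinuousLinearMap.adjoint (S t) φ)‖ ^ 2) (Ioi 0) := by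
    intro t ht
    obtain ⟨S', hS'⟩ := hSan.exists_hasDerivAt ht
    have h := DFunLike.congr_fun (negFracPower_mul_mul_eq hS hSan hρ hγ hγ' ht hS') φ
    have hG : (ρ • ContinuousLinearMap.adjoint (S t) - ContinuousLinearMap.adjoint S') φ
        = ContinuousLinearMap.adjoint (S t) ψ := by
      rw [hψ, map_sub, map_smul, ← hA.adjoint_deriv_apply hS hSan ht hS' ⟨φ, hφ⟩]
      rfl
    rw [mul_apply_eq_comp, hG] at h
    simp only
    rw [← hL, ← h]
    rfl
  obtain ⟨K, hK, hb⟩ := hS.exists_bound_on T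
  rw [intervalIntegrable_iff_integrableOn_Ioc_of_le hT]
  have hsub : Ioc 0 T ⊆ Ioi (0 : ℝ) := Ioc_subset_Ioi_self
  refine IntegrableOn.congr_fun ?_ (hrep.mono hsub) measurableSet_Ioc
  refine IntegrableOn.of_bound (by simp) ?_ ((‖L‖ * (‖Q‖ * (K * ‖ψ‖))) ^ 2) ?_
  · exact (((L.continuous.comp Q.continuous).comp_continuousOn
      ((continuousOn_adjoint_apply hSan ψ).mono hsub)).norm.pow 2).aestronglyMeasurable
      measurableSet_Ioc
  · refine (ae_restrict_iff' measurableSet_Ioc).2 (Eventually.of_forall fun t ht => ?_)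
    rw [Real.norm_of_nonneg (by positivity)]
    gcongr
    refine L.le_of_opNorm_le_of_le le_rfl (Q.le_of_opNorm_le_of_le le_rfl ?_)
    refine ContinuousLinearMap.le_of_opNorm_le _ ?_ ψ
    rw [LinearIsometryEquiv.norm_map]
    exact hb t ht.1.le ht.2

theorem commute_adjoint_of_isStarProjection {P S : X →L[𝕜] X} (hP : IsStarProjection P)
    (h : P.comp S = S.comp P) : Commute P (ContinuousLinearMap.adjoint S) := by
  have hP' : ContinuousLinearMap.adjoint P = P := hP.isSelfAdjoint.adjoint_eq
  have h' := congrArg ContinuousLinearMap.adjoint h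
  rw [ContinuousLinearMap.adjoint_comp, ContinuousLinearMap.adjoint_comp, hP'] at h'
  exact h'.symm

/-- The projected observation over a window of length `T₀` after time `τ > 1` is controlled by the
observation itself, up to the decay of the complementary part. -/
theorem exists_integral_projected_observation_le {A : X →ₗ.[𝕜] X} {S : ℝ → X →L[𝕜] X}
    (hS : IsC0Semigroup S) (hA : IsGenerator A S) (hSan : IsAnalyticSemigroup S) {ρ γ : ℝ}
    (hρ : growthBound S < (ρ : EReal)) (hγ : 0 < γ) (hγ' : γ < 1)
    (B : U →L[𝕜] ExtrapolationSpace S ρ γ) {P : X →L[𝕜] X} (hP : IsStarProjection P)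
    (hcomm : ∀ t : ℝ, 0 ≤ t → P.comp (S t) = (S t).comp P) {M β : ℝ} (hM : 0 ≤ M) (hβ : 0 ≤ β)
    (hdiss : ∀ t : ℝ, 0 ≤ t → ∀ φ : X,
      ‖ContinuousLinearMap.adjoint (S t) φ - P (ContinuousLinearMap.adjoint (S t) φ)‖
        ≤ M * Real.exp (-β * t) * ‖φ‖) :
    ∃ K : ℝ, 0 ≤ K ∧ ∀ T₀ τ : ℝ, 0 ≤ T₀ → 1 < τ → ∀ φ ∈ A.adjoint.domain,
      ∫ t in (0 : ℝ)..T₀, ‖controlAdjoint B (P (ContinuousLinearMap.adjoint (S t)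
          (ContinuousLinearMap.adjoint (S τ) φ)))‖ ^ 2
        ≤ 2 * (∫ t in (0 : ℝ)..(T₀ + τ),
            ‖controlAdjoint B (ContinuousLinearMap.adjoint (S t) φ)‖ ^ 2)
          + 2 * T₀ * (K * Real.exp (-β * (τ - 1)) * ‖φ‖) ^ 2 := by
  obtain ⟨L, hL⟩ := exists_controlAdjoint_negFracPower B (negFracPower_injective hS hSan hρ hγ hγ')
  obtain ⟨R, hR, hRc⟩ := exists_negFracPower_mul_eq_adjoint hS hSan hρ hγ hγ' one_pos
  refine ⟨‖L‖ * (M * ‖R‖), by positivity, fun T₀ τ hT₀ hτ φ hφ => ?_⟩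
  have hPN : Commute P (negFracPower S ρ γ) := commute_negFracPower hS hSan hρ hγ fun t ht =>
    commute_adjoint_of_isStarProjection hP (hcomm t ht.le)
  have hadd : ∀ s t : ℝ, 0 ≤ s → 0 ≤ t → ∀ y, ContinuousLinearMap.adjoint (S s)
      (ContinuousLinearMap.adjoint (S t) y) = ContinuousLinearMap.adjoint (S (s + t)) y :=
    fun s t hs ht y => (DFunLike.congr_fun (hS.adjoint_add hs ht) y).symm
  -- S(t+τ)*φ = N_γ z(t): one unit of time pays for N_γ, and τ > 1 keeps the remaining time
  -- positive, so z is continuous up to t = 0.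
  set z : ℝ → X := fun t => R (ContinuousLinearMap.adjoint (S (t + (τ - 1))) φ) with hz
  have hrep : ∀ t, 0 ≤ t → ContinuousLinearMap.adjoint (S (t + τ)) φ = negFracPower S ρ γ (z t) :=
    fun t ht => by
      rw [hz, hR, hadd 1 _ zero_le_one (by linarith)]
      congr 3
      ring
  have hobsP : ∀ t, 0 ≤ t → controlAdjoint B (P (ContinuousLinearMap.adjoint (S t)
      (ContinuousLinearMap.adjoint (S τ) φ))) = L (P (z t)) := fun t ht => by
    rw [hadd t τ ht (by linarith), hrep t ht, ← hL]
    exact congrArg _ (DFunLike.congr_fun hPN.eq (z t))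
  have hobs : ∀ t, 0 ≤ t → controlAdjoint B (ContinuousLinearMap.adjoint (S (t + τ)) φ)
      = L (z t) := fun t ht => by rw [hrep t ht, hL]
  have hrest : ∀ t, 0 ≤ t → ‖L (z t - P (z t))‖
      ≤ ‖L‖ * (M * ‖R‖) * Real.exp (-β * (τ - 1)) * ‖φ‖ := fun t ht => by
    refine (L.le_opNorm _).trans ?_
    have h1 : ‖z t - P (z t)‖ ≤ M * Real.exp (-β * (t + (τ - 1))) * ‖R φ‖ := by
      rw [hz]
      simp only [hRc (t + (τ - 1)) (by linarith) φ]
      exact hdiss _ (by linarith) _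
    have h2 : Real.exp (-β * (t + (τ - 1))) ≤ Real.exp (-β * (τ - 1)) := by
      rw [Real.exp_le_exp]; nlinarith
    calc ‖L‖ * ‖z t - P (z t)‖
        ≤ ‖L‖ * (M * Real.exp (-β * (τ - 1)) * (‖R‖ * ‖φ‖)) := by
          gcongr
          refine h1.trans ?_
          gcongr
          exact R.le_opNorm φ
      _ = _ := by ring
  set c := ‖L‖ * (M * ‖R‖) * Real.exp (-β * (τ - 1)) * ‖φ‖ with hc
  set g : ℝ → ℝ := fun t => ‖controlAdjoint B (ContinuousLinearMap.adjoint (S t) φ)‖ ^ 2 with hg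
  have hgint : IntervalIntegrable g volume 0 (T₀ + τ) :=
    intervalIntegrable_sq_norm_controlAdjoint hS hA hSan hρ hγ hγ' B hφ (by linarith)
  have hgτ : IntervalIntegrable g volume τ (T₀ + τ) := by
    refine hgint.mono_set ?_
    rw [uIcc_of_le (by linarith), uIcc_of_le (by linarith)]
    exact Icc_subset_Icc_left (by linarith)
  have hgs : IntervalIntegrable (fun t => g (t + τ)) volume 0 T₀ := by
    simpa using hgτ.comp_add_right τ
  have hzc : ContinuousOn z (Icc 0 T₀) := by
    refine R.continuous.comp_continuousOn ((continuousOn_adjoint_apply hSan φ).comp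
      (by fun_prop) fun t ht => ?_)
    have := ht.1
    simp only [mem_Ioi]
    linarith
  have hleft : IntervalIntegrable (fun t => ‖L (P (z t))‖ ^ 2) volume 0 T₀ := by
    refine ContinuousOn.intervalIntegrable ?_
    rw [uIcc_of_le hT₀]
    exact ((L.continuous.comp P.continuous).comp_continuousOn hzc).norm.pow 2
  calc ∫ t in (0 : ℝ)..T₀, ‖controlAdjoint B (P (ContinuousLinearMap.adjoint (S t)
          (ContinuousLinearMap.adjoint (S τ) φ)))‖ ^ 2
      = ∫ t in (0 : ℝ)..T₀, ‖L (P (z t))‖ ^ 2 := by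
        refine intervalIntegral.integral_congr fun t ht => ?_
        rw [uIcc_of_le hT₀] at ht
        simp only [hobsP t ht.1]
    _ ≤ ∫ t in (0 : ℝ)..T₀, (2 * g (t + τ) + 2 * c ^ 2) := by
        refine intervalIntegral.integral_mono_on hT₀ hleft
          ((hgs.const_mul 2).add intervalIntegrable_const) fun t ht => ?_
        have e : L (P (z t)) = L (z t) - L (z t - P (z t)) := by rw [map_sub]; abel
        have h1 : ‖L (P (z t))‖ ≤ ‖L (z t)‖ + c := by
          rw [e]
          exact (norm_sub_le _ _).trans (by gcongr; exact hrest t ht.1)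
        simp only [hg, hobs t ht.1]
        nlinarith [sq_nonneg (‖L (z t)‖ - c), norm_nonneg (L (P (z t))),
          pow_le_pow_left₀ (norm_nonneg (L (P (z t)))) h1 2]
    _ = 2 * (∫ t in τ..(T₀ + τ), g t) + 2 * T₀ * c ^ 2 := by
        rw [intervalIntegral.integral_add (hgs.const_mul 2) intervalIntegrable_const,
          intervalIntegral.integral_const_mul, intervalIntegral.integral_comp_add_right,
          intervalIntegral.integral_const]
        simp only [zero_add, smul_eq_mul, sub_zero]
        ring
    _ ≤ _ := by
        gcongr
        refine intervalIntegral.integral_mono_interval (by linarith) (by linarith) le_rfl ?_ hgint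
        exact Eventually.of_forall fun t => by positivity

end Observation

end ControlSystem

end

/-! ### The weak observability inequality. -/

theorem theorem4p4 {𝕜 : Type*} [RCLike 𝕜]
    {X : Type*} [NormedAddCommGroup X] [InnerProductSpace 𝕜 X] [CompleteSpace X]
    {U : Type*} [NormedAddCommGroup U] [InnerProductSpace 𝕜 U] [CompleteSpace U]
    (A : X →ₗ.[𝕜] X) (S : ℝ → X →L[𝕜] X)
    (hS : ControlSystem.IsC0Semigroup S) (hA : ControlSystem.IsGenerator A S) (hSan : ControlSystem.IsAnalyticSemigroup S)
    (γ : ℝ) (hγ : γ ∈ Set.Ioo (0 : ℝ) (1 / 2))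
    (ρ₀ : ℝ) (hρ₀ : ControlSystem.growthBound S < (ρ₀ : EReal))
    (B : U →L[𝕜] ControlSystem.ExtrapolationSpace S ρ₀ γ)
    (P : ℕ+ → X →L[𝕜] X) (hP : ∀ k, IsStarProjection (P k))
    (hcomm : ∀ k, ∀ t : ℝ, 0 ≤ t → (P k).comp (S t) = (S t).comp (P k))
    (hdiss : ∃ M α : ℕ+ → ℝ, (∀ k, 0 < M k) ∧ (∀ k, 0 < α k) ∧
      Filter.Tendsto α Filter.atTop Filter.atTop ∧
      ∀ k, ∀ t : ℝ, 0 ≤ t → ∀ φ : X,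
        ‖ContinuousLinearMap.adjoint (S t) φ - P k (ContinuousLinearMap.adjoint (S t) φ)‖
          ≤ M k * Real.exp (-α k * t) * ‖φ‖)
    (hobs : ∃ T₀ : ℝ, 0 < T₀ ∧ ∀ k, ∃ C : ℝ, 0 < C ∧ ∀ φ ∈ A.adjoint.domain,
      ‖P k (ContinuousLinearMap.adjoint (S T₀) φ)‖ ^ 2
        ≤ C * ∫ t in (0 : ℝ)..T₀,
            ‖ControlSystem.controlAdjoint B (P k (ContinuousLinearMap.adjoint (S t) φ))‖ ^ 2) :
    ∃ T₀ : ℝ, 0 ≤ T₀ ∧ ∀ α : ℝ, 0 < α → ∃ C : ℝ, 0 < C ∧ ∀ T : ℝ, T₀ < T →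
      ∃ D : ℝ, 0 < D ∧ ∀ φ ∈ A.adjoint.domain,
        ‖ContinuousLinearMap.adjoint (S T) φ‖
          ≤ D * Real.sqrt (∫ t in (0 : ℝ)..T,
                ‖ControlSystem.controlAdjoint B (ContinuousLinearMap.adjoint (S (T - t)) φ)‖ ^ 2)
            + C * Real.exp (-α * T) * ‖φ‖ := by
  obtain ⟨M, β, hM, hβ, hβtop, hdec⟩ := hdiss
  obtain ⟨T₀, hT₀, hobs⟩ := hobs
  have hγ' : γ < 1 := by linarith [hγ.2]
  refine ⟨T₀ + 1, by linarith, fun α hα => ?_⟩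
  -- The index k, and with it C, K and M k, depends on α but not on T.
  obtain ⟨k, hk⟩ := (hβtop.eventually_ge_atTop α).exists
  obtain ⟨C, hC, hobs⟩ := hobs k
  obtain ⟨K, hK, hKle⟩ := ControlSystem.exists_integral_projected_observation_le hS hA hSan hρ₀
    hγ.1 hγ' B (hP k) (hcomm k) (hM k).le (hβ k).le (hdec k)
  -- The first summand comes from the error in the projected observation, where e^{α(T₀+1)} restores
  -- the time T₀ + 1 lost in the decay; `M k` comes from the complement of P_k at time T.
  refine ⟨√(2 * C * T₀) * (K * Real.exp (α * (T₀ + 1))) + M k,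
    add_pos_of_nonneg_of_pos (by positivity) (hM k), fun T hT =>
    ⟨√(2 * C), by positivity, fun φ hφ => ?_⟩⟩
  have hτ : 1 < T - T₀ := by linarith
  have hsplit : ContinuousLinearMap.adjoint (S T₀) (ContinuousLinearMap.adjoint (S (T - T₀)) φ)
      = ContinuousLinearMap.adjoint (S T) φ := by
    have h := hS.adjoint_add hT₀.le (show 0 ≤ T - T₀ by linarith)
    rw [add_sub_cancel] at h
    exact (DFunLike.congr_fun h φ).symm
  -- Hypothesis 3 is applied to S(T - T₀)*φ, which lies in D(A*) by smoothing.
  have h1 := hobs _ (hA.adjoint_apply_mem_domain hS hSan (show 0 < T - T₀ by linarith) φ)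
  have h2 := hKle T₀ (T - T₀) hT₀.le hτ φ hφ
  rw [hsplit] at h1
  rw [add_sub_cancel] at h2
  rw [intervalIntegral.integral_comp_sub_left
    (fun t => ‖ControlSystem.controlAdjoint B (ContinuousLinearMap.adjoint (S t) φ)‖ ^ 2) T,
    sub_self, sub_zero]
  set I := ∫ t in (0 : ℝ)..T,
    ‖ControlSystem.controlAdjoint B (ContinuousLinearMap.adjoint (S t) φ)‖ ^ 2
  have hI : 0 ≤ I := intervalIntegral.integral_nonneg (by linarith) fun t _ => by positivity
  have hexp : Real.exp (-β k * (T - T₀ - 1)) ≤ Real.exp (α * (T₀ + 1)) * Real.exp (-α * T) := by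
    rw [← Real.exp_add, Real.exp_le_exp]
    nlinarith
  have hexp' : Real.exp (-β k * T) ≤ Real.exp (-α * T) := by
    rw [Real.exp_le_exp]
    nlinarith
  have hproj : ‖P k (ContinuousLinearMap.adjoint (S T) φ)‖
      ≤ √(2 * C) * √I + √(2 * C * T₀) * (K * Real.exp (-β k * (T - T₀ - 1)) * ‖φ‖) := by
    -- Comparison of squares: a² + b² ≤ (a + b)² for a, b ≥ 0.
    refine abs_le_of_sq_le_sq' ?_ (by positivity) |>.2
    set e := K * Real.exp (-β k * (T - T₀ - 1)) * ‖φ‖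
    have he : 0 ≤ e := by positivity
    have hs1 : √(2 * C) ^ 2 = 2 * C := Real.sq_sqrt (by positivity)
    have hs2 : √(2 * C * T₀) ^ 2 = 2 * C * T₀ := Real.sq_sqrt (by positivity)
    have hs3 : √I ^ 2 = I := Real.sq_sqrt hI
    have hcross : 0 ≤ √(2 * C) * √I * (√(2 * C * T₀) * e) := by positivity
    calc ‖P k (ContinuousLinearMap.adjoint (S T) φ)‖ ^ 2
        ≤ C * (2 * I + 2 * T₀ * e ^ 2) := h1.trans (by gcongr)
      _ = √(2 * C) ^ 2 * √I ^ 2 + √(2 * C * T₀) ^ 2 * e ^ 2 := by rw [hs1, hs2, hs3]; ring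
      _ ≤ _ := by nlinarith
  have hrest := hdec k T (by linarith) φ
  calc ‖ContinuousLinearMap.adjoint (S T) φ‖
      ≤ ‖P k (ContinuousLinearMap.adjoint (S T) φ)‖ + ‖ContinuousLinearMap.adjoint (S T) φ
          - P k (ContinuousLinearMap.adjoint (S T) φ)‖ := norm_le_insert' _ _
    _ ≤ (√(2 * C) * √I + √(2 * C * T₀)
          * (K * (Real.exp (α * (T₀ + 1)) * Real.exp (-α * T)) * ‖φ‖))
          + M k * Real.exp (-α * T) * ‖φ‖ := by
        refine add_le_add (hproj.trans ?_) (hrest.trans ?_)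
        · gcongr
        · have := (hM k).le
          gcongr
    _ = _ := by ring
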